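/- All groups are finite and all characters are complex. For a set $N$ of positive integers, the Gruenberg--Kegel graph of $N$ has as vertices the primes dividing some element of $N$, two distinct primes $p,q$ being adjacent if and only if $pq$ divides some element of $N$. The prime graph $\Gamma_e(G)$ of a group $G$ is the Gruenberg--Kegel graph of the set of orders of elements of $G$. The codegree graph $\Gamma(G)$ is the Gruenberg--Kegel graph of the set of codegrees $\mathrm{cod}(\chi)=|G:\ker\chi|/\chi(1)$, where $\chi$ runs over the irreducible characters of $G$. For distinct odd primes $q$ and $r$, let $\mathcal{F}(q,r)$ be the class of groups isomorphic to $V\rtimes(Q\rtimes P)$, where $P\cong\mathbb{Z}_4$, $Q\cong\mathbb{Z}_q\times\mathbb{Z}_q$, the action of $P$ on $Q$ is Frobenius (that is, $C_Q(a)=1$ for every $1\ne a\in P$), and $V$ is the additive group of a finite faithful irreducible $\mathbb{F}_r[Q\rtimes P]$-module, with $Q\rtimes P$ acting on $V$ through the module structure. **Proposition.** 1. There are infinitely many pairwise non-isomorphic solvable groups $G$ whose prime graph $\Gamma_e(G)$ is a path on $3$ vertices while the codegree graph $\Gamma(G)$ is a triangle; infinitely many such groups lie in $\bigcup_{q,r}\mathcal{F}(q,r)$,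 the union being over all pairs of distinct odd primes. 2. For all distinct odd primes $q$ and $r$, every group $G$ in $\mathcal{F}(q,r)$ is solvable, its prime graph $\Gamma_e(G)$ is a path on $3$ vertices, and its codegree graph $\Gamma(G)$ is a triangle. 3. For all distinct odd primes $q$ and $r$, the class $\mathcal{F}(q,r)$ is non-empty. -/

import Mathlib

/-- The Gruenberg-Kegel graph of a set `N` of natural numbers: its vertices are the primes dividing
some element of `N`, and distinct `p`, `q` are adjacent iff `p * q` divides some element of `N`. -/
def gruenbergKegelGraph (N : Set ℕ) : SimpleGraph {p : ℕ // p.Prime ∧ ∃ n ∈ N, p ∣ n} where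
  Adj p q := p ≠ q ∧ ∃ n ∈ N, (p : ℕ) * (q : ℕ) ∣ n
  symm := ⟨fun _ _ h => ⟨h.1.symm, h.2.imp fun _ hn => ⟨hn.1, by rw [mul_comm]; exact hn.2⟩⟩⟩
  loopless := ⟨fun _ h => h.1 rfl⟩

/-- The set of element orders of a group. -/
def elementOrders (G : Type*) [Group G] : Set ℕ := Set.range (orderOf : G → ℕ)

/-- The prime graph of a (finite) group. -/
abbrev primeGraph (G : Type*) [Group G] := gruenbergKegelGraph (elementOrders G)

/-- The codegree `|G : ker χ| / χ(1)` of the character `χ` afforded by a complex representation;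
`ker χ` is the kernel of the representation. The quotient is taken in `ℂ`, so nothing is
rounded. -/
noncomputable def characterCodegree {G W : Type*} [Group G] [AddCommGroup W] [Module ℂ W]
    (σ : Representation ℂ G W) : ℂ :=
  ((MonoidHom.ker σ).index : ℂ) / σ.character 1

/-- The set of codegrees of the irreducible complex characters of `G`. Every such character is
afforded by an irreducible representation on some `ℂ ^ d`. -/
def codegrees (G : Type*) [Group G] : Set ℕ :=
  {n | ∃ (d : ℕ) (σ : Representation ℂ G (Fin d → ℂ)),
    σ.IsIrreducible ∧ (n : ℂ) = characterCodegree σ}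

/-- The codegree graph of a (finite) group. -/
abbrev codegreeGraph (G : Type*) [Group G] := gruenbergKegelGraph (codegrees G)

/-- The graph is a path on three vertices (a path with two edges). -/
def IsTwoPath {X : Type*} (Γ : SimpleGraph X) : Prop := Nonempty (Γ ≃g SimpleGraph.pathGraph 3)

/-- The graph is a triangle. -/
def IsTriangle {X : Type*} (Γ : SimpleGraph X) : Prop := Nonempty (Γ ≃g SimpleGraph.completeGraph (Fin 3))

/-- The action of a group `P` on a group `N` is Frobenius (fixed-point-free): `C_N(a) = 1` for
every `a ≠ 1` in `P`. -/
def IsFrobeniusAction {P N : Type*} [Group P] [Group N] (φ : P →* MulAut N) : Prop :=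
  ∀ a : P, a ≠ 1 → ∀ x : N, φ a x = x → x = 1

/-- The action by automorphisms on the additive group of `V`, written multiplicatively, given by a
linear representation on `V`. -/
def representationAction {k H V : Type*} [CommRing k] [Group H] [AddCommGroup V] [Module k V]
    (ρ : Representation k H V) : H →* MulAut (Multiplicative V) where
  toFun h :=
    { toFun := fun v => Multiplicative.ofAdd (ρ h v.toAdd)
      invFun := fun v => Multiplicative.ofAdd (ρ h⁻¹ v.toAdd)
      left_inv := fun v => by simp
      right_inv := fun v => by simp
      map_mul' := fun v w => by simp }
  map_one' := by ext v; simp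
  map_mul' g h := by ext v; simp

/-- `G ≅ V ⋊ (Q ⋊ P)`, where `P ≅ ℤ/4` acts Frobeniusly on `Q ≅ ℤ/q × ℤ/q` and `V` is (the
additive group of) a faithful irreducible finite module of `Q ⋊ P` over the field with `r`
elements. -/
def IsModuleExtensionOfFrobenius (q r : ℕ) [Fact r.Prime] (G : Type*) [Group G] : Prop :=
  ∃ (φ : Multiplicative (ZMod 4) →* MulAut (Multiplicative (ZMod q × ZMod q)))
    (V : Type) (_ : AddCommGroup V) (_ : Finite V) (_ : Module (ZMod r) V)
    (ρ : Representation (ZMod r)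
      (Multiplicative (ZMod q × ZMod q) ⋊[φ] Multiplicative (ZMod 4)) V),
    IsFrobeniusAction φ ∧ Function.Injective ρ ∧ ρ.IsIrreducible ∧
      Nonempty (G ≃* Multiplicative V ⋊[representationAction ρ]
        (Multiplicative (ZMod q × ZMod q) ⋊[φ] Multiplicative (ZMod 4)))

/-! Write `H = Q ⋊ P` and `z` for the involution of `P`. The primes dividing `|V ⋊ H|` are exactly
`2`, `q`, `r`, so only adjacency is in question. Everything rests on one nonzero `w` in `V` fixed
both by some `x ≠ 1` in `Q` and by `z` (`exists_common_fixed_vector`). Such an `x` with fixed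
vectors exists because `Q` is not cyclic. As `z` inverts `Q`, it acts on the fixed space of `x`;
were it without fixed vectors there, it would be `-1` on all of `V`, hence central in `H` by
faithfulness, contradicting the Frobenius action.

Prime graph: `w` commutes with `z` and with `x`, giving elements of orders `2r` and `rq`. An element
of order `2q` would project to one of the same order in `H`, which the Frobenius action forbids.

Codegree graph: averaging turns `w` into a nontrivial linear character of `V` invariant under the
stabilizer `D` of `w`. Its `H`-orbit carries a faithful irreducible monomial representation whose
codegree is a multiple of `|V| |D|`, hence of `2qr` (`exists_mem_codegrees_of_fixed`). One codegree
thus yields all three edges.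

Existence: an irreducible constituent of the sum-zero part of a permutation module on `2q` points is
already faithful. Fixing `q = 3` and varying `r` gives infinitely many groups, told apart by the
primes dividing their orders. -/

/-! ### Recognizing triangles and two-edge paths -/

theorem isTriangle_gruenbergKegelGraph {N : Set ℕ} {a b c : ℕ}
    (hab : a ≠ b) (hac : a ≠ c) (hbc : b ≠ c)
    (hv : ∀ p : ℕ, (p.Prime ∧ ∃ n ∈ N, p ∣ n) ↔ p = a ∨ p = b ∨ p = c)
    (hN : ∃ n ∈ N, a * b * c ∣ n) : IsTriangle (gruenbergKegelGraph N) := by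
  obtain ⟨n, hn, hd⟩ := hN
  let f : Fin 3 → {p : ℕ // p.Prime ∧ ∃ n ∈ N, p ∣ n} :=
    ![⟨a, (hv a).2 (by simp)⟩, ⟨b, (hv b).2 (by simp)⟩, ⟨c, (hv c).2 (by simp)⟩]
  have hf : Function.Bijective f := by
    constructor
    · intro i j h
      fin_cases i <;> fin_cases j <;> simp_all [f, eq_comm]
    · rintro ⟨p, hp⟩
      rcases (hv p).1 hp with rfl | rfl | rfl
      exacts [⟨0, rfl⟩, ⟨1, rfl⟩, ⟨2, rfl⟩]
  have key : ∀ i j, i ≠ j → (f i : ℕ) * f j ∣ a * b * c := by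
    intro i j h
    fin_cases i <;> fin_cases j <;> simp [f] at h ⊢
    exacts [⟨b, by ring⟩, ⟨c, by ring⟩, ⟨a, by ring⟩, ⟨b, by ring⟩, ⟨a, by ring⟩]
  refine ⟨RelIso.symm ⟨Equiv.ofBijective f hf, fun {i j} => ?_⟩⟩
  change (f i ≠ f j ∧ ∃ n ∈ N, (f i : ℕ) * f j ∣ n) ↔ i ≠ j
  rw [hf.1.ne_iff]
  exact ⟨fun h => h.1, fun h => ⟨h, n, hn, (key i j h).trans hd⟩⟩

theorem isTwoPath_gruenbergKegelGraph {N : Set ℕ} {a b c : ℕ}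
    (hab : a ≠ b) (hac : a ≠ c) (hbc : b ≠ c)
    (hv : ∀ p : ℕ, (p.Prime ∧ ∃ n ∈ N, p ∣ n) ↔ p = a ∨ p = b ∨ p = c)
    (h₁ : ∃ n ∈ N, a * b ∣ n) (h₂ : ∃ n ∈ N, b * c ∣ n) (h₃ : ¬ ∃ n ∈ N, a * c ∣ n) :
    IsTwoPath (gruenbergKegelGraph N) := by
  let f : Fin 3 → {p : ℕ // p.Prime ∧ ∃ n ∈ N, p ∣ n} :=
    ![⟨a, (hv a).2 (by simp)⟩, ⟨b, (hv b).2 (by simp)⟩, ⟨c, (hv c).2 (by simp)⟩]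
  have hf : Function.Bijective f := by
    constructor
    · intro i j h
      fin_cases i <;> fin_cases j <;> simp_all [f, eq_comm]
    · rintro ⟨p, hp⟩
      rcases (hv p).1 hp with rfl | rfl | rfl
      exacts [⟨0, rfl⟩, ⟨1, rfl⟩, ⟨2, rfl⟩]
  have h₁' : ∃ n ∈ N, b * a ∣ n := by rwa [mul_comm b a]
  have h₂' : ∃ n ∈ N, c * b ∣ n := by rwa [mul_comm c b]
  have h₃' : ¬ ∃ n ∈ N, c * a ∣ n := by rwa [mul_comm c a]
  push Not at h₃ h₃'
  refine ⟨RelIso.symm ⟨Equiv.ofBijective f hf, fun {i j} => ?_⟩⟩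
  change (f i ≠ f j ∧ ∃ n ∈ N, (f i : ℕ) * f j ∣ n) ↔ (SimpleGraph.pathGraph 3).Adj i j
  rw [hf.1.ne_iff, SimpleGraph.pathGraph_adj]
  fin_cases i <;> fin_cases j <;> simp [f] <;> assumption

/-! ### Irreducibility through invariant subspaces -/

namespace Representation

variable {k G V W : Type*} [Field k] [Group G] [AddCommGroup V] [Module k V]
  [AddCommGroup W] [Module k W]

theorem isIrreducible_iff_forall_submodule (ρ : Representation k G V) :
    ρ.IsIrreducible ↔ Nontrivial V ∧ ∀ U : Submodule k V, (∀ g, ∀ v ∈ U, ρ g v ∈ U) →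
      U = ⊥ ∨ U = ⊤ := by
  constructor
  · intro h
    refine ⟨?_, fun U hU => ?_⟩
    · by_contra hV
      rw [not_nontrivial_iff_subsingleton] at hV
      exact bot_ne_top (α := Subrepresentation ρ)
        (Subrepresentation.toSubmodule_injective (Subsingleton.elim _ _))
    · rcases eq_bot_or_eq_top (⟨U, fun g v hv => hU g v hv⟩ : Subrepresentation ρ) with h | h
      · exact Or.inl (congrArg Subrepresentation.toSubmodule h)
      · exact Or.inr (congrArg Subrepresentation.toSubmodule h)
  · rintro ⟨hV, h⟩
    have : Nontrivial (Subrepresentation ρ) :=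
      ⟨⊥, ⊤, fun h => bot_ne_top (α := Submodule k V)
        (congrArg Subrepresentation.toSubmodule h)⟩
    refine { eq_bot_or_eq_top := fun U => ?_ }
    rcases h U.toSubmodule (fun g v hv => U.apply_mem_toSubmodule g hv) with h | h
    · exact Or.inl (Subrepresentation.toSubmodule_injective h)
    · exact Or.inr (Subrepresentation.toSubmodule_injective h)

theorem IsIrreducible.nontrivial {ρ : Representation k G V} (h : ρ.IsIrreducible) :
    Nontrivial V :=
  ((isIrreducible_iff_forall_submodule ρ).1 h).1

theorem IsIrreducible.eq_bot_or_eq_top_of_invariant {ρ : Representation k G V}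
    (h : ρ.IsIrreducible) (U : Submodule k V) (hU : ∀ g, ∀ v ∈ U, ρ g v ∈ U) :
    U = ⊥ ∨ U = ⊤ :=
  ((isIrreducible_iff_forall_submodule ρ).1 h).2 U hU

theorem IsIrreducible.comp_surjective {K : Type*} [Group K] {ρ : Representation k G V}
    (h : ρ.IsIrreducible) (f : K →* G) (hf : Function.Surjective f) :
    IsIrreducible (MonoidHom.comp ρ f : Representation k K V) := by
  rw [isIrreducible_iff_forall_submodule] at h ⊢
  refine ⟨h.1, fun U hU => h.2 U fun g v hv => ?_⟩
  obtain ⟨x, rfl⟩ := hf g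
  exact hU x v hv

/-- Transport of a representation along a linear equivalence. -/
def congrEquiv (ρ : Representation k G V) (e : V ≃ₗ[k] W) : Representation k G W where
  toFun g := e.conj (ρ g)
  map_one' := by ext; simp
  map_mul' g h := by ext; simp

theorem congrEquiv_apply (ρ : Representation k G V) (e : V ≃ₗ[k] W) (g : G) (w : W) :
    ρ.congrEquiv e g w = e (ρ g (e.symm w)) := rfl

theorem IsIrreducible.congrEquiv {ρ : Representation k G V} (h : ρ.IsIrreducible)
    (e : V ≃ₗ[k] W) : (ρ.congrEquiv e).IsIrreducible := by
  rw [isIrreducible_iff_forall_submodule] at h ⊢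
  have := h.1
  refine ⟨e.symm.toEquiv.nontrivial, fun U hU => ?_⟩
  rcases h.2 (U.comap e.toLinearMap) (fun g v hv => by
    have := hU g _ hv
    simpa [congrEquiv_apply] using this) with h | h
  · left
    rw [eq_bot_iff]
    intro w hw
    have : e.symm w ∈ U.comap e.toLinearMap := by simpa using hw
    rw [h] at this
    simpa using this
  · right
    rw [eq_top_iff]
    intro w _
    have : e.symm w ∈ U.comap e.toLinearMap := by rw [h]; trivial
    simpa using this

theorem ker_congrEquiv (ρ : Representation k G V) (e : V ≃ₗ[k] W) :
    MonoidHom.ker (ρ.congrEquiv e) = MonoidHom.ker ρ := by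
  ext g
  refine ⟨fun h => ?_, fun h => ?_⟩
  · ext v
    have := LinearMap.congr_fun (MonoidHom.mem_ker.1 h) (e v)
    simpa [congrEquiv_apply] using this
  · ext w
    simp [congrEquiv_apply, MonoidHom.mem_ker.1 h]

end Representation

/-! ### Codegrees and element orders: divisibility, inflation, isomorphism -/

theorem mem_codegrees_of_isIrreducible {G W : Type*} [Group G] [AddCommGroup W] [Module ℂ W]
    [FiniteDimensional ℂ W] {σ : Representation ℂ G W} (hσ : σ.IsIrreducible) {n : ℕ}
    (hn : n * Module.finrank ℂ W = (MonoidHom.ker σ).index) : n ∈ codegrees G := by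
  let e : W ≃ₗ[ℂ] (Fin (Module.finrank ℂ W) → ℂ) := (Module.finBasis ℂ W).equivFun
  have := hσ.nontrivial
  refine ⟨_, σ.congrEquiv e, hσ.congrEquiv e, ?_⟩
  rw [characterCodegree, Representation.ker_congrEquiv, Representation.char_one, ← hn]
  have h0 : (Module.finrank ℂ W : ℂ) ≠ 0 := by exact_mod_cast Module.finrank_pos.ne'
  simp [h0]

theorem dvd_card_of_mem_codegrees {G : Type*} [Group G] {n : ℕ} (hn : n ∈ codegrees G) :
    n ∣ Nat.card G := by
  obtain ⟨d, σ, hσ, h⟩ := hn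
  have := hσ.nontrivial
  rw [characterCodegree, Representation.char_one] at h
  have h0 : (Module.finrank ℂ (Fin d → ℂ) : ℂ) ≠ 0 := by exact_mod_cast Module.finrank_pos.ne'
  rw [eq_div_iff h0] at h
  have h' : n * Module.finrank ℂ (Fin d → ℂ) = (MonoidHom.ker σ).index := by exact_mod_cast h
  exact (Dvd.intro _ h').trans (Subgroup.index_dvd_card _)

theorem codegrees_subset_of_surjective {G K : Type*} [Group G] [Group K] (f : G →* K)
    (hf : Function.Surjective f) : codegrees K ⊆ codegrees G := by
  rintro n ⟨d, σ, hσ, h⟩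
  refine ⟨d, MonoidHom.comp σ f, hσ.comp_surjective f hf, ?_⟩
  rw [h, characterCodegree, characterCodegree, Representation.char_one, Representation.char_one,
    ← MonoidHom.comap_ker, Subgroup.index_comap_of_surjective _ hf]

theorem codegrees_eq_of_mulEquiv {G K : Type*} [Group G] [Group K] (e : G ≃* K) :
    codegrees G = codegrees K :=
  (codegrees_subset_of_surjective (e.symm : K →* G) e.symm.surjective).antisymm
    (codegrees_subset_of_surjective (e : G →* K) e.surjective)

theorem elementOrders_eq_of_mulEquiv {G K : Type*} [Group G] [Group K] (e : G ≃* K) :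
    elementOrders G = elementOrders K := by
  ext n
  constructor
  · rintro ⟨g, rfl⟩
    exact ⟨e g, e.orderOf_eq g⟩
  · rintro ⟨g, rfl⟩
    exact ⟨e.symm g, e.symm.orderOf_eq g⟩

/-! ### Monomial representations of semidirect products -/

/-- The monomial representation of `A ⋊[α] H` on functions on an `H`-set `X` whose points carry
characters of `A` compatibly with the actions of `H`. -/
def SemidirectProduct.monomialRep {A H X : Type*} [CommGroup A] [Group H] {α : H →* MulAut A}
    [MulAction H X] (m : X → A →* ℂˣ) (hm : ∀ (h : H) x a, m (h⁻¹ • x) a = m x (α h a)) :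
    Representation ℂ (A ⋊[α] H) (X → ℂ) where
  toFun g :=
    { toFun := fun f x => (m x g.left : ℂ) * f (g.right⁻¹ • x)
      map_add' := fun f f' => by ext x; simp [mul_add]
      map_smul' := fun c f => by ext x; simp; ring }
  map_one' := by ext; simp
  map_mul' g g' := by
    refine LinearMap.ext fun f => funext fun x => ?_
    simp [hm, mul_smul, mul_assoc]

namespace SemidirectProduct

variable {A H X : Type*} [CommGroup A] [Group H] {α : H →* MulAut A}
    [MulAction H X] (m : X → A →* ℂˣ) (hm : ∀ (h : H) x a, m (h⁻¹ • x) a = m x (α h a))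

theorem monomialRep_apply (g : A ⋊[α] H) (f : X → ℂ) (x : X) :
    monomialRep m hm g f x = (m x g.left : ℂ) * f (g.right⁻¹ • x) := rfl

/-- Distinct points carry distinct characters of `A`, so by orthogonality a nonzero invariant
subspace contains a point mass; transitivity of `H` then supplies all of them. -/
theorem isIrreducible_monomialRep [Finite A] [Finite X] [Nonempty X]
    [MulAction.IsPretransitive H X] (hinj : Function.Injective m) :
    (monomialRep m hm).IsIrreducible := by
  classical
  have := Fintype.ofFinite A
  have := Fintype.ofFinite X
  rw [Representation.isIrreducible_iff_forall_submodule]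
  refine ⟨inferInstance, fun U hU => ?_⟩
  rw [or_iff_not_imp_left]
  intro hbot
  obtain ⟨f, hf, hf0⟩ := Submodule.exists_mem_ne_zero_of_ne_bot hbot
  obtain ⟨x₀, hx₀⟩ := Function.ne_iff.1 hf0
  -- Up to the factor `|A|`, this is the projection of `f` to the isotypic component of `m x₀`.
  have hsum : ∑ a : A, ((m x₀ a : ℂ))⁻¹ • monomialRep m hm (inl a) f ∈ U :=
    U.sum_mem fun a _ => U.smul_mem _ (hU _ _ hf)
  have heq : ∑ a : A, ((m x₀ a : ℂ))⁻¹ • monomialRep m hm (inl a) f =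
      Pi.single x₀ ((Fintype.card A : ℂ) * f x₀) := by
    ext x
    rw [Finset.sum_apply]
    simp only [Pi.smul_apply, monomialRep_apply, left_inl, right_inl, inv_one, one_smul,
      smul_eq_mul]
    by_cases hx : x = x₀
    · subst hx
      simp
    · have hne : (Units.coeHom ℂ).comp (m x / m x₀) ≠ 1 := by
        intro h
        apply hx
        apply hinj
        rw [← div_eq_one]
        ext a
        exact DFunLike.congr_fun h a
      have := sum_hom_units_eq_zero _ hne
      rw [Pi.single_eq_of_ne hx, ← zero_mul (f x), ← this, Finset.sum_mul]
      refine Finset.sum_congr rfl fun a _ => ?_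
      simp
      ring
  have hx₀U : Pi.single x₀ (1 : ℂ) ∈ U := by
    have h := U.smul_mem ((Fintype.card A : ℂ) * f x₀)⁻¹ (heq ▸ hsum)
    rw [← Pi.single_smul, smul_eq_mul, inv_mul_cancel₀] at h
    · exact h
    · exact mul_ne_zero (by simp) hx₀
  have hall : ∀ x, Pi.single x (1 : ℂ) ∈ U := by
    intro x
    obtain ⟨h, rfl⟩ := MulAction.exists_smul_eq H x₀ x
    have := hU (inr h) _ hx₀U
    convert this using 1
    ext y
    rw [monomialRep_apply, left_inr, right_inr, map_one, Units.val_one, one_mul]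
    by_cases hy : y = h • x₀
    · subst hy
      simp
    · rw [Pi.single_eq_of_ne hy, Pi.single_eq_of_ne]
      rwa [Ne, inv_smul_eq_iff]
  rw [eq_top_iff]
  intro f _
  rw [pi_eq_sum_univ' f]
  refine U.sum_mem fun x _ => U.smul_mem _ ?_
  convert hall x using 1

theorem injective_monomialRep (hA : ∀ a, (∀ x, m x a = 1) → a = 1)
    (hH : ∀ h : H, (∀ x a, m x (α h a) = m x a) → h = 1) :
    Function.Injective (monomialRep m hm) := by
  rw [injective_iff_map_eq_one]
  classical
  intro g hg
  have key : ∀ (f : X → ℂ) x, (m x g.left : ℂ) * f (g.right⁻¹ • x) = f x := fun f x =>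
    congrFun (DFunLike.congr_fun hg f) x
  have h1 : g.left = 1 := hA _ fun x => Units.ext (by simpa using key 1 x)
  have h2 : g.right = 1 := by
    refine hH _ fun x a => ?_
    rw [← hm]
    have := key (Pi.single x 1) x
    rw [h1, map_one, Units.val_one, one_mul, Pi.single_eq_same, Pi.single_apply] at this
    split_ifs at this with h
    · rw [h]
    · simp at this
  exact SemidirectProduct.ext h1 h2

end SemidirectProduct

/-! ### Common fixed vectors -/

/-- The lines through the origin cover `ZMod q × ZMod q`. If no nontrivial element fixes a nonzero
vector, the sum over each line kills `V`. Adding up the non-vertical lines counts the origin `q`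
times and every point off the vertical axis once, which forces `q • v = 0`. -/
theorem Representation.exists_fixed_of_zmod_prod_zmod {k V : Type*} [Field k] [AddCommGroup V]
    [Module k V] [Nontrivial V] {q : ℕ} [Fact q.Prime] (hq : (q : k) ≠ 0)
    (ρ : Representation k (Multiplicative (ZMod q × ZMod q)) V) :
    ∃ x ≠ 1, ∃ v ≠ 0, ρ x v = v := by
  by_contra! h
  replace h : ∀ x ≠ 1, ∀ v, ρ x v = v → v = 0 := fun x hx v hv => by
    by_contra h0
    exact h x hx v h0 hv
  have hadd : ∀ a b c d : ZMod q, ∀ v, ρ (.ofAdd (a, b)) (ρ (.ofAdd (c, d)) v) =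
      ρ (.ofAdd (a + c, b + d)) v := fun a b c d v => by
    rw [← Module.End.mul_apply, ← map_mul, ← ofAdd_add, Prod.mk_add_mk]
  have h1 : ∀ i v, ∑ j : ZMod q, ρ (.ofAdd (j, i * j)) v = 0 := fun i v => by
    refine h (.ofAdd (1, i)) (by simp [← ofAdd_zero, Prod.ext_iff]) _ ?_
    rw [map_sum]
    simp only [hadd]
    exact Fintype.sum_equiv (Equiv.addLeft 1) _ _ fun j => by simp [mul_add]
  have h2 : ∀ v, ∑ i : ZMod q, ρ (.ofAdd (0, i)) v = 0 := fun v => by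
    refine h (.ofAdd (0, 1)) (by simp [← ofAdd_zero, Prod.ext_iff]) _ ?_
    rw [map_sum]
    simp only [hadd]
    exact Fintype.sum_equiv (Equiv.addLeft 1) _ _ fun j => by simp
  obtain ⟨v, hv⟩ := exists_ne (0 : V)
  have h3 : ∑ i : ZMod q, ∑ j : ZMod q, ρ (.ofAdd (j, i * j)) v = 0 := by simp [h1]
  rw [Finset.sum_comm, Finset.sum_eq_single (0 : ZMod q)] at h3
  · have : ρ (.ofAdd (0, 0)) v = v := by
      rw [← Prod.zero_eq_mk, ofAdd_zero, map_one, Module.End.one_apply]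
    simp only [mul_zero, this, Finset.sum_const, Finset.card_univ, ZMod.card] at h3
    rw [← Nat.cast_smul_eq_nsmul k, smul_eq_zero] at h3
    exact h3.elim hq hv
  -- For `j ≠ 0` the points `(j, i * j)` run through a translate of the vertical line, so their sum
  -- vanishes.
  · intro j _ hj
    rw [← h2 (ρ (.ofAdd (j, 0)) v)]
    simp only [hadd]
    exact Fintype.sum_equiv (Equiv.mulRight₀ j hj) _ _ fun i => by simp
  · simp

/-- The product `φ z x * x` is fixed by `z`, hence trivial. -/
theorem IsFrobeniusAction.apply_eq_inv {P N : Type*} [Group P] [CommGroup N] {φ : P →* MulAut N}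
    (hφ : IsFrobeniusAction φ) {z : P} (hz : z ≠ 1) (hz2 : z * z = 1) (x : N) :
    φ z x = x⁻¹ := by
  rw [eq_inv_iff_mul_eq_one]
  refine hφ z hz _ ?_
  rw [map_mul, ← MulAut.mul_apply, ← map_mul, hz2, map_one, MulAut.one_apply, mul_comm]

theorem exists_fixed_by_involution {k V Q P : Type*} [Field k] [AddCommGroup V] [Module k V]
    [CommGroup Q] [CommGroup P] {φ : P →* MulAut Q} (hφ : IsFrobeniusAction φ)
    {ρ : Representation k (Q ⋊[φ] P) V} (hinj : Function.Injective ρ) (hρ : ρ.IsIrreducible)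
    {z : P} (hz : z ≠ 1) (hz2 : z * z = 1) {x : Q} (hx : x ≠ 1) {v : V} (hv : v ≠ 0)
    (hxv : ρ (.inl x) v = v) :
    ∃ w ≠ 0, ρ (.inl x) w = w ∧ ρ (.inr z) w = w := by
  by_contra! hno
  have hmul : ∀ g h u, ρ g (ρ h u) = ρ (g * h) u := fun g h u => by
    rw [map_mul, Module.End.mul_apply]
  have hzx : (SemidirectProduct.inl x : Q ⋊[φ] P) * .inr z = .inr z * .inl x⁻¹ := by
    ext <;> simp [hφ.apply_eq_inv hz hz2]
  -- Since `z` inverts `x`, the vector `u + z u` is fixed by both, so it must be zero.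
  have hneg : ∀ u, ρ (.inl x) u = u → ρ (.inr z) u = -u := by
    intro u hu
    have hu' : ρ (.inl x⁻¹) u = u := by
      conv_lhs => rw [← hu]
      rw [hmul, ← map_mul, inv_mul_cancel, map_one, map_one, Module.End.one_apply]
    by_contra h
    refine hno (u + ρ (.inr z) u) (fun h0 => h (by rwa [add_comm, add_eq_zero_iff_eq_neg] at h0))
      ?_ ?_
    · rw [map_add, hu, hmul, hzx, ← hmul, hu']
    · rw [map_add, hmul, ← map_mul, hz2, map_one, map_one, Module.End.one_apply, add_comm]
  let S : Submodule k V := Submodule.span k {w | ∃ g u, ρ (.inl x) u = u ∧ ρ g u = w}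
  have hS : ∀ g, ∀ w ∈ S, ρ g w ∈ S := by
    intro g w hw
    induction hw using Submodule.span_induction with
    | mem w hw =>
      obtain ⟨g', u, hu, rfl⟩ := hw
      exact Submodule.subset_span ⟨g * g', u, hu, (hmul _ _ _).symm⟩
    | zero => rw [map_zero]; exact S.zero_mem
    | add a b _ _ ha hb => rw [map_add]; exact S.add_mem ha hb
    | smul c a _ ha => rw [map_smul]; exact S.smul_mem c ha
  have hvS : v ∈ S := Submodule.subset_span ⟨1, v, hxv, by simp⟩
  have hST : S = ⊤ := (hρ.eq_bot_or_eq_top_of_invariant S hS).resolve_left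
    fun h => hv (by rwa [h] at hvS)
  have hall : ∀ w, ρ (.inr z) w = -w := by
    intro w
    have hw : w ∈ S := hST ▸ Submodule.mem_top
    induction hw using Submodule.span_induction with
    | mem w hw =>
      obtain ⟨g, u, hu, rfl⟩ := hw
      -- With the `P`-part on the left, `z` moves past it because `P` is abelian; the remaining
      -- `Q`-part keeps `u` in the fixed space of `x` because `Q` is abelian.
      have hg : g = .inr g.right * .inl (φ g.right⁻¹ g.left) := by
        rw [SemidirectProduct.inl_aut, inv_inv, map_inv]
        simp only [← mul_assoc, mul_inv_cancel, one_mul]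
        exact (SemidirectProduct.inl_left_mul_inr_right g).symm
      rw [hg, ← hmul, hmul, ← map_mul, mul_comm z, map_mul, ← hmul, hneg _ ?_, map_neg]
      rw [hmul, ← map_mul, mul_comm x, map_mul, ← hmul, hu]
    | zero => simp
    | add a b _ _ ha hb => rw [map_add, ha, hb, neg_add]
    | smul c a _ ha => rw [map_smul, ha, smul_neg]
  have hcomm : (SemidirectProduct.inr z : Q ⋊[φ] P) * .inl x = .inl x * .inr z := by
    apply hinj
    ext w
    rw [map_mul, map_mul, Module.End.mul_apply, Module.End.mul_apply, hall, hall, map_neg]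
  refine hx (hφ z hz x ?_)
  simpa using congrArg SemidirectProduct.left hcomm

/-! ### From a fixed vector to a large codegree -/

/-- The action on the linear characters of `A` induced by an action on `A`. -/
abbrev dualAction {A H : Type*} [CommGroup A] [Group H] (α : H →* MulAut A) :
    MulAction H (A →* ℂˣ) where
  smul h μ := μ.comp (α h⁻¹).toMonoidHom
  one_smul μ := by ext a; change (μ (α 1⁻¹ a) : ℂ) = _; simp
  mul_smul g h μ := by
    ext a
    change (μ (α (g * h)⁻¹ a) : ℂ) = (μ (α h⁻¹ (α g⁻¹ a)) : ℂ)
    rw [mul_inv_rev, map_mul, MulAut.mul_apply]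

/-- Multiply the `D`-twists of a character `ψ` with `ψ w ≠ 1`: the product is invariant, and its
value `ψ w ^ |D|` at `w` is nontrivial by coprimality. -/
theorem exists_invariant_character {A D : Type*} [CommGroup A] [Finite A] [Group D] [Finite D]
    (α : D →* MulAut A) {w : A} (hw : w ≠ 1) (hD : (Nat.card D).Coprime (orderOf w))
    (hfix : ∀ d, α d w = w) :
    ∃ μ : A →* ℂˣ, μ w ≠ 1 ∧ ∀ d a, μ (α d a) = μ a := by
  have := Fintype.ofFinite D
  obtain ⟨ψ, hψ⟩ := CommGroup.exists_apply_ne_one_of_hasEnoughRootsOfUnity A ℂ hw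
  refine ⟨∏ d, ψ.comp (α d).toMonoidHom, ?_, fun d a => ?_⟩
  · intro h
    apply hψ
    have h1 : ψ w ^ Nat.card D = 1 := by
      rw [← h, MonoidHom.finsetProd_apply]
      simp [hfix]
    have h2 : ψ w ^ orderOf w = 1 := by rw [← map_pow, pow_orderOf_eq_one, map_one]
    exact (orderOf_eq_one_iff).1 (Nat.eq_one_of_dvd_coprimes hD (orderOf_dvd_of_pow_eq_one h1)
      (orderOf_dvd_of_pow_eq_one h2))
  · rw [MonoidHom.finsetProd_apply, MonoidHom.finsetProd_apply]
    exact Fintype.prod_equiv (Equiv.mulRight d) _ _ fun e => by simp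

theorem exists_mem_codegrees_of_fixed {r : ℕ} [Fact r.Prime] {H V : Type*} [Group H] [Finite H]
    [AddCommGroup V] [Finite V] [Module (ZMod r) V] {ρ : Representation (ZMod r) H V}
    (hinj : Function.Injective ρ) (hρ : ρ.IsIrreducible) (hr : ¬ r ∣ Nat.card H)
    {w : V} (hw : w ≠ 0) (D : Subgroup H) (hD : ∀ h ∈ D, ρ h w = w) :
    ∃ n ∈ codegrees (Multiplicative V ⋊[representationAction ρ] H),
      Nat.card V * Nat.card D ∣ n := by
  have hrp : r.Prime := Fact.out
  have hword : orderOf (Multiplicative.ofAdd w) = r := by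
    rw [orderOf_ofAdd_eq_addOrderOf]
    refine addOrderOf_eq_prime ?_ hw
    rw [← Nat.cast_smul_eq_nsmul (ZMod r), CharP.cast_eq_zero, zero_smul]
  obtain ⟨μ, hμw, hμ⟩ := exists_invariant_character (w := Multiplicative.ofAdd w)
    ((representationAction ρ).comp D.subtype) (by simpa using hw)
    (by
      rw [hword, Nat.coprime_comm, hrp.coprime_iff_not_dvd]
      exact fun h => hr (h.trans (Subgroup.card_subgroup_dvd_card D)))
    (fun d => congrArg Multiplicative.ofAdd (hD d d.2))
  let := dualAction (representationAction ρ)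
  have hsmul : ∀ (h : H) (ν : Multiplicative V →* ℂˣ) a,
      (h • ν) a = ν (representationAction ρ h⁻¹ a) := fun _ _ _ => rfl
  let X := MulAction.orbit H μ
  have : Nonempty X := ⟨⟨μ, MulAction.mem_orbit_self μ⟩⟩
  have : Finite X := Set.finite_range _
  let m : X → Multiplicative V →* ℂˣ := Subtype.val
  have hm : ∀ (h : H) x a, m (h⁻¹ • x) a = m x (representationAction ρ h a) := by
    intro h x a
    change (h⁻¹ • (x : Multiplicative V →* ℂˣ)) a = _
    rw [hsmul, inv_inv]
  -- The common kernel of the `H`-conjugates of `μ` is invariant and misses `w`, so irreducibility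
  -- makes it zero. Faithfulness of the monomial representation follows from this.
  let U : Submodule (ZMod r) V := AddSubgroup.toZModSubmodule r
    { carrier := {v | ∀ h, μ (representationAction ρ h (.ofAdd v)) = 1}
      add_mem' := fun ha hb h => by rw [ofAdd_add, map_mul, map_mul, ha, hb, mul_one]
      zero_mem' := fun h => by rw [ofAdd_zero, map_one, map_one]
      neg_mem' := fun ha h => by rw [ofAdd_neg, map_inv, map_inv, ha, inv_one] }
  have hU : ∀ v, v ∈ U ↔ ∀ h, μ (representationAction ρ h (.ofAdd v)) = 1 := fun v => Iff.rfl
  have hUbot : U = ⊥ := by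
    refine (hρ.eq_bot_or_eq_top_of_invariant U fun g v hv => ?_).resolve_right fun h => hμw ?_
    · rw [hU] at hv ⊢
      intro h
      have := hv (h * g)
      rwa [map_mul] at this
    · have : w ∈ U := h ▸ Submodule.mem_top
      rw [hU] at this
      simpa using this 1
  have hA : ∀ a, (∀ x, m x a = 1) → a = 1 := by
    intro a ha
    have : a.toAdd ∈ U := by
      rw [hU]
      intro h
      have := ha ⟨h⁻¹ • μ, h⁻¹, rfl⟩
      change (h⁻¹ • μ) a = 1 at this
      rwa [hsmul, inv_inv] at this
    rw [hUbot] at this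
    exact this
  have hH : ∀ h : H, (∀ x a, m x (representationAction ρ h a) = m x a) → h = 1 := by
    intro h hh
    apply hinj
    rw [map_one]
    ext v
    have := hA (representationAction ρ h (.ofAdd v) / .ofAdd v) fun x => by
      rw [map_div, hh, div_self']
    rw [div_eq_one] at this
    exact this
  have hker : MonoidHom.ker (SemidirectProduct.monomialRep m hm) = ⊥ :=
    (MonoidHom.ker_eq_bot_iff _).2 (SemidirectProduct.injective_monomialRep m hm hA hH)
  have := Fintype.ofFinite X
  -- The kernel is trivial and the degree is the orbit length, so the codegree is `|V| |H|` divided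
  -- by the length of the orbit.
  refine ⟨Nat.card V * Nat.card (MulAction.stabilizer H μ), mem_codegrees_of_isIrreducible
    (SemidirectProduct.isIrreducible_monomialRep m hm Subtype.val_injective) ?_, ?_⟩
  · rw [hker, Subgroup.index_bot, SemidirectProduct.card, Module.finrank_fintype_fun_eq_card,
      ← Nat.card_eq_fintype_card, mul_assoc, mul_comm (Nat.card (MulAction.stabilizer H μ)),
      ← Nat.card_prod, Nat.card_congr (MulAction.orbitProdStabilizerEquivGroup H μ)]
    rfl
  · refine mul_dvd_mul_left _ (Subgroup.card_dvd_of_le fun d hd => ?_)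
    rw [MulAction.mem_stabilizer_iff]
    exact MonoidHom.ext fun a => hμ ⟨d⁻¹, D.inv_mem hd⟩ a

/-! ### Group orders and element orders -/

theorem Representation.IsIrreducible.prime_dvd_natCard_iff {r : ℕ} [Fact r.Prime] {H V : Type*}
    [Group H] [AddCommGroup V] [Finite V] [Module (ZMod r) V] {ρ : Representation (ZMod r) H V}
    (hρ : ρ.IsIrreducible) {p : ℕ} (hp : p.Prime) : p ∣ Nat.card V ↔ p = r := by
  have := hρ.nontrivial
  have : Module.Finite (ZMod r) V := Module.Finite.of_finite
  rw [Module.natCard_eq_pow_finrank (K := ZMod r), Nat.card_zmod,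
    hp.prime.dvd_pow_iff_dvd Module.finrank_pos.ne', Nat.prime_dvd_prime_iff_eq hp Fact.out]

theorem Nat.Prime.dvd_mul_self_mul_iff {p : ℕ} (hp : p.Prime) (m n : ℕ) :
    p ∣ m * m * n ↔ p ∣ m ∨ p ∣ n := by
  rw [hp.dvd_mul, hp.dvd_mul, or_self]

theorem natCard_square_semidirect_zmod_four {q : ℕ}
    (φ : Multiplicative (ZMod 4) →* MulAut (Multiplicative (ZMod q × ZMod q))) :
    Nat.card (Multiplicative (ZMod q × ZMod q) ⋊[φ] Multiplicative (ZMod 4)) = q * q * 4 := by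
  rw [SemidirectProduct.card, Nat.card_congr Multiplicative.toAdd, Nat.card_prod, Nat.card_zmod,
    Nat.card_congr Multiplicative.toAdd, Nat.card_zmod]

/-- Otherwise `h ^ l` would be a nontrivial element of `Q` commuting with `h ^ q`, whose `P`-part is
nontrivial and would therefore fix it. -/
theorem IsFrobeniusAction.not_dvd_orderOf {Q P : Type*} [CommGroup Q] [Group P]
    {φ : P →* MulAut Q} (hφ : IsFrobeniusAction φ) {l q : ℕ} (hl : l.Coprime q)
    (hl1 : l ≠ 1) (hq1 : q ≠ 1) (hq0 : q ≠ 0)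
    (hQ : ∀ x : Q, x ^ q = 1) (hP : ∀ a : P, a ^ q = 1 → a = 1) (h : Q ⋊[φ] P) :
    orderOf h ≠ l * q := by
  intro ho
  have hright : ∀ n, (h ^ n).right = h.right ^ n := fun n => map_pow SemidirectProduct.rightHom h n
  have hl0 : l ≠ 0 := by
    rintro rfl
    rw [Nat.coprime_zero_left] at hl
    exact hq1 hl
  have h1 : h ^ q ≠ 1 := fun hc => by
    have := Nat.le_of_dvd (Nat.pos_of_ne_zero hq0) (ho ▸ orderOf_dvd_of_pow_eq_one hc)
    have : 2 * q ≤ l * q := Nat.mul_le_mul_right q (by omega)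
    omega
  have h2 : h ^ l ≠ 1 := fun hc => by
    have := Nat.le_of_dvd (Nat.pos_of_ne_zero hl0) (ho ▸ orderOf_dvd_of_pow_eq_one hc)
    have : l * 2 ≤ l * q := Nat.mul_le_mul_left l (by omega)
    omega
  have h3 : h ^ (l * q) = 1 := ho ▸ pow_orderOf_eq_one h
  have hy : (h ^ l).right = 1 := hP _ (by
    rw [hright, ← pow_mul, ← hright, h3, SemidirectProduct.one_right])
  have hy1 : (h ^ l).left ≠ 1 := fun hc => h2 (SemidirectProduct.ext hc hy)
  have ha : (h ^ q).right ≠ 1 := by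
    intro hc
    have hin : h ^ q = .inl (h ^ q).left := SemidirectProduct.ext rfl hc
    have e1 : (h ^ q) ^ q = 1 := by rw [hin, ← map_pow, hQ, map_one]
    have e2 : (h ^ q) ^ l = 1 := by rw [← pow_mul, mul_comm, h3]
    exact h1 (orderOf_eq_one_iff.1 (Nat.eq_one_of_dvd_coprimes hl (orderOf_dvd_of_pow_eq_one e2)
      (orderOf_dvd_of_pow_eq_one e1)))
  have hc : h ^ q * h ^ l = h ^ l * h ^ q := by rw [← pow_add, ← pow_add, add_comm]
  refine hy1 (hφ _ ha _ ?_)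
  have := congrArg SemidirectProduct.left hc
  rw [SemidirectProduct.mul_left, SemidirectProduct.mul_left, hy, map_one, MulAut.one_apply,
    mul_comm (h ^ l).left] at this
  exact mul_left_cancel this

/-- Raising `g` to the order of its image lands in `N`, which has exponent dividing `r`; coprimality
removes the factor `r`. -/
theorem SemidirectProduct.orderOf_right_of_coprime {N H : Type*} [Group N] [Group H]
    {α : H →* MulAut N} {r n : ℕ} (hN : ∀ x : N, x ^ r = 1) (hn : n.Coprime r) {g : N ⋊[α] H}
    (hg : orderOf g = n) : orderOf g.right = n := by
  refine Nat.dvd_antisymm (hg ▸ orderOf_map_dvd SemidirectProduct.rightHom g) ?_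
  have h1 : (g ^ orderOf g.right).right = 1 := by
    change SemidirectProduct.rightHom (g ^ orderOf g.right) = 1
    rw [map_pow]
    exact pow_orderOf_eq_one g.right
  have h2 : g ^ orderOf g.right = .inl (g ^ orderOf g.right).left :=
    SemidirectProduct.ext rfl h1
  have h3 : g ^ (orderOf g.right * r) = 1 := by
    rw [pow_mul, h2, ← map_pow, hN, map_one]
  exact hn.dvd_of_dvd_mul_right (hg ▸ orderOf_dvd_of_pow_eq_one h3)

/-! ### The two graphs of the module extension -/

section ModuleExtension

variable {q r : ℕ} [Fact q.Prime] [Fact r.Prime]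
  {φ : Multiplicative (ZMod 4) →* MulAut (Multiplicative (ZMod q × ZMod q))}
  {V : Type*} [AddCommGroup V] [Module (ZMod r) V]
  {ρ : Representation (ZMod r)
    (Multiplicative (ZMod q × ZMod q) ⋊[φ] Multiplicative (ZMod 4)) V}

theorem pow_eq_one_of_zmod_prod (x : Multiplicative (ZMod q × ZMod q)) : x ^ q = 1 := by
  rw [← ofAdd_toAdd x, ← ofAdd_nsmul, ofAdd_eq_one]
  ext <;> simp

theorem pow_eq_one_of_zmod_module {r : ℕ} {V : Type*} [AddCommGroup V] [Module (ZMod r) V]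
    (v : Multiplicative V) : v ^ r = 1 := by
  rw [← ofAdd_toAdd v, ← ofAdd_nsmul, ofAdd_eq_one, ← Nat.cast_smul_eq_nsmul (ZMod r),
    CharP.cast_eq_zero, zero_smul]

theorem ofAdd_two_ne_one : Multiplicative.ofAdd (2 : ZMod 4) ≠ 1 := by decide

theorem ofAdd_two_mul_self : Multiplicative.ofAdd (2 : ZMod 4) * Multiplicative.ofAdd 2 = 1 := by
  decide

theorem exists_common_fixed_vector (hrq : r ≠ q)
    (hφ : IsFrobeniusAction φ) (hinj : Function.Injective ρ) (hρ : ρ.IsIrreducible) :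
    ∃ x ≠ 1, ∃ w ≠ 0, ρ (.inl x) w = w ∧ ρ (.inr (.ofAdd 2)) w = w := by
  have := hρ.nontrivial
  have hq : (q : ZMod r) ≠ 0 := by
    rw [Ne, CharP.cast_eq_zero_iff (ZMod r) r, Nat.prime_dvd_prime_iff_eq Fact.out Fact.out]
    exact hrq
  obtain ⟨x, hx, v, hv, hxv⟩ := Representation.exists_fixed_of_zmod_prod_zmod hq
    (MonoidHom.comp ρ SemidirectProduct.inl)
  exact ⟨x, hx, exists_fixed_by_involution hφ hinj hρ ofAdd_two_ne_one ofAdd_two_mul_self hx hv hxv⟩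

theorem prime_dvd_natCard_moduleExtension_iff [Finite V] (hρ : ρ.IsIrreducible) {p : ℕ} (hp : p.Prime) :
    p ∣ Nat.card (Multiplicative V ⋊[representationAction ρ]
      (Multiplicative (ZMod q × ZMod q) ⋊[φ] Multiplicative (ZMod 4))) ↔
      p = 2 ∨ p = r ∨ p = q := by
  have hq : q.Prime := Fact.out
  rw [SemidirectProduct.card, natCard_square_semidirect_zmod_four,
    Nat.card_congr Multiplicative.toAdd, hp.dvd_mul, hρ.prime_dvd_natCard_iff hp,
    hp.dvd_mul_self_mul_iff, Nat.prime_dvd_prime_iff_eq hp hq, show 4 = 2 ^ 2 by rfl,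
    hp.prime.dvd_pow_iff_dvd two_ne_zero, Nat.prime_dvd_prime_iff_eq hp Nat.prime_two]
  tauto

theorem orderOf_inl_mul_inr {N H : Type*} [Group N] [Group H] {α : H →* MulAut N} {n : N} {h : H}
    (hfix : α h n = n) (hc : (orderOf n).Coprime (orderOf h)) :
    orderOf (.inl n * .inr h : N ⋊[α] H) = orderOf n * orderOf h := by
  have hn : orderOf (.inl n : N ⋊[α] H) = orderOf n :=
    orderOf_injective _ SemidirectProduct.inl_injective n
  have hh : orderOf (.inr h : N ⋊[α] H) = orderOf h :=
    orderOf_injective _ SemidirectProduct.inr_injective h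
  rw [← hn, ← hh] at hc ⊢
  refine Commute.orderOf_mul_eq_mul_orderOf_of_coprime ?_ hc
  ext <;> simp [hfix]

theorem graphs_of_moduleExtension [Finite V] (hq2 : q ≠ 2) (hr2 : r ≠ 2) (hrq : r ≠ q)
    (hφ : IsFrobeniusAction φ) (hinj : Function.Injective ρ) (hρ : ρ.IsIrreducible)
    {G : Type*} [Group G] (e : G ≃* Multiplicative V ⋊[representationAction ρ]
      (Multiplicative (ZMod q × ZMod q) ⋊[φ] Multiplicative (ZMod 4))) :
    IsTwoPath (primeGraph G) ∧ IsTriangle (codegreeGraph G) := by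
  have hqp : q.Prime := Fact.out
  have hrp : r.Prime := Fact.out
  have hqr : q.Coprime r := (Nat.coprime_primes hqp hrp).2 hrq.symm
  have h2q : Nat.Coprime 2 q := (Nat.coprime_primes Nat.prime_two hqp).2 hq2.symm
  have h2r : Nat.Coprime 2 r := (Nat.coprime_primes Nat.prime_two hrp).2 hr2.symm
  obtain ⟨x, hx, w, hw, hxw, hzw⟩ := exists_common_fixed_vector hrq hφ hinj hρ
  have hox : orderOf (.inl x : Multiplicative (ZMod q × ZMod q) ⋊[φ] Multiplicative (ZMod 4)) = q := by
    rw [orderOf_injective _ SemidirectProduct.inl_injective]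
    exact orderOf_eq_prime (pow_eq_one_of_zmod_prod x) hx
  have hoz : orderOf (.inr (.ofAdd 2) :
      Multiplicative (ZMod q × ZMod q) ⋊[φ] Multiplicative (ZMod 4)) = 2 := by
    rw [orderOf_injective _ SemidirectProduct.inr_injective]
    exact orderOf_eq_prime (by rw [pow_two, ofAdd_two_mul_self]) ofAdd_two_ne_one
  have how : orderOf (Multiplicative.ofAdd w) = r :=
    orderOf_eq_prime (pow_eq_one_of_zmod_module _) (by simpa using hw)
  have hfin : Finite (Multiplicative (ZMod q × ZMod q) ⋊[φ] Multiplicative (ZMod 4)) :=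
    Finite.of_equiv _ SemidirectProduct.equivProd.symm
  have hfinG : Finite (Multiplicative V ⋊[representationAction ρ]
      (Multiplicative (ZMod q × ZMod q) ⋊[φ] Multiplicative (ZMod 4))) :=
    Finite.of_equiv _ SemidirectProduct.equivProd.symm
  have hfix : ∀ h, ρ h w = w → representationAction ρ h (.ofAdd w) = .ofAdd w := fun h hh =>
    congrArg Multiplicative.ofAdd hh
  rw [primeGraph, codegreeGraph, elementOrders_eq_of_mulEquiv e, codegrees_eq_of_mulEquiv e]
  constructor
  · refine isTwoPath_gruenbergKegelGraph (a := 2) (b := r) (c := q) hr2.symm hq2.symm hrq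
      (fun p => ?_) ?_ ?_ ?_
    · constructor
      · rintro ⟨hp, _, ⟨g, rfl⟩, hpg⟩
        exact (prime_dvd_natCard_moduleExtension_iff hρ hp).1 (hpg.trans (orderOf_dvd_natCard g))
      · intro h
        have hp : p.Prime := by rcases h with rfl | rfl | rfl; exacts [Nat.prime_two, hrp, hqp]
        have := Fact.mk hp
        obtain ⟨g, hg⟩ := exists_prime_orderOf_dvd_card' p ((prime_dvd_natCard_moduleExtension_iff hρ hp).2 h)
        exact ⟨hp, p, ⟨g, hg⟩, dvd_rfl⟩
    · refine ⟨_, ⟨.inl (.ofAdd w) * .inr (.inr (.ofAdd 2)), rfl⟩, ?_⟩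
      rw [orderOf_inl_mul_inr (hfix _ hzw) (by rw [how, hoz]; exact h2r.symm), how, hoz, mul_comm]
    · refine ⟨_, ⟨.inl (.ofAdd w) * .inr (.inl x), rfl⟩, ?_⟩
      rw [orderOf_inl_mul_inr (hfix _ hxw) (by rw [how, hox]; exact hqr.symm), how, hox]
    · rintro ⟨_, ⟨g, rfl⟩, hg⟩
      -- A suitable power of `g` has order exactly `2 * q`.
      have h1 := orderOf_pow_orderOf_div (orderOf_pos g).ne' hg
      have h2 := SemidirectProduct.orderOf_right_of_coprime pow_eq_one_of_zmod_module
        (Nat.Coprime.mul_left h2r hqr) h1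
      refine hφ.not_dvd_orderOf h2q (by norm_num) hqp.one_lt.ne' hqp.ne_zero
        pow_eq_one_of_zmod_prod (fun a ha => ?_) _ h2
      have h4 : a ^ 4 = 1 := by clear ha; revert a; decide
      have h4q : Nat.Coprime (2 ^ 2) q := h2q.pow_left 2
      exact orderOf_eq_one_iff.1 (Nat.eq_one_of_dvd_coprimes h4q (orderOf_dvd_of_pow_eq_one h4)
        (orderOf_dvd_of_pow_eq_one ha))
  · let D : Subgroup (Multiplicative (ZMod q × ZMod q) ⋊[φ] Multiplicative (ZMod 4)) :=
      { carrier := {h | ρ h w = w}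
        one_mem' := by simp
        mul_mem' := fun {a b} ha hb => by
          rw [Set.mem_ofPred_eq] at *
          rw [map_mul, Module.End.mul_apply, hb, ha]
        inv_mem' := fun {a} ha => by
          rw [Set.mem_ofPred_eq] at *
          conv_lhs => rw [← ha]
          rw [← Module.End.mul_apply, ← map_mul, inv_mul_cancel, map_one, Module.End.one_apply] }
    have hrH : ¬ r ∣ Nat.card (Multiplicative (ZMod q × ZMod q) ⋊[φ] Multiplicative (ZMod 4)) := by
      rw [natCard_square_semidirect_zmod_four, hrp.dvd_mul_self_mul_iff,
        Nat.prime_dvd_prime_iff_eq hrp hqp, show 4 = 2 ^ 2 by rfl,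
        hrp.prime.dvd_pow_iff_dvd two_ne_zero, Nat.prime_dvd_prime_iff_eq hrp Nat.prime_two]
      tauto
    obtain ⟨n, hn, hdvd⟩ := exists_mem_codegrees_of_fixed hinj hρ hrH hw D fun _ h => h
    have hD : 2 * q ∣ Nat.card D := by
      refine h2q.mul_dvd_of_dvd_of_dvd ?_ ?_
      · exact hoz.symm.dvd.trans (D.orderOf_dvd_natCard hzw)
      · exact hox.symm.dvd.trans (D.orderOf_dvd_natCard hxw)
    have hdn : 2 * r * q ∣ n := by
      refine dvd_trans ?_ hdvd
      rw [mul_comm 2 r, mul_assoc]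
      exact mul_dvd_mul ((hρ.prime_dvd_natCard_iff hrp).2 rfl) hD
    refine isTriangle_gruenbergKegelGraph (a := 2) (b := r) (c := q) hr2.symm hq2.symm hrq
      (fun p => ?_) ⟨n, hn, hdn⟩
    constructor
    · rintro ⟨hp, m, hm, hpm⟩
      exact (prime_dvd_natCard_moduleExtension_iff hρ hp).1 (hpm.trans (dvd_card_of_mem_codegrees hm))
    · rintro (rfl | rfl | rfl)
      · exact ⟨Nat.prime_two, n, hn, dvd_trans ⟨r * q, by ring⟩ hdn⟩
      · exact ⟨hrp, n, hn, dvd_trans ⟨2 * q, by ring⟩ hdn⟩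
      · exact ⟨hqp, n, hn, dvd_trans ⟨2 * r, by ring⟩ hdn⟩

end ModuleExtension

/-! ### Finiteness, solvability and prime divisors -/

theorem SemidirectProduct.isSolvable {N H : Type*} [Group N] [Group H] {α : H →* MulAut N}
    [Group.IsSolvable N] [Group.IsSolvable H] : Group.IsSolvable (N ⋊[α] H) :=
  Group.isSolvable_of_ker_le_range inl rightHom range_inl_eq_ker_rightHom.ge

theorem IsModuleExtensionOfFrobenius.finite {q r : ℕ} [Fact q.Prime] [Fact r.Prime] {G : Type*}
    [Group G] (h : IsModuleExtensionOfFrobenius q r G) : Finite G := by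
  obtain ⟨φ, V, _, _, _, ρ, -, -, -, ⟨e⟩⟩ := h
  have : Finite (Multiplicative (ZMod q × ZMod q) ⋊[φ] Multiplicative (ZMod 4)) :=
    Finite.of_equiv _ SemidirectProduct.equivProd.symm
  exact Finite.of_equiv _ (SemidirectProduct.equivProd.symm.trans e.symm.toEquiv)

theorem IsModuleExtensionOfFrobenius.isSolvable {q r : ℕ} [Fact r.Prime] {G : Type*}
    [Group G] (h : IsModuleExtensionOfFrobenius q r G) : Group.IsSolvable G := by
  obtain ⟨φ, V, _, _, _, ρ, -, -, -, ⟨e⟩⟩ := h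
  have := SemidirectProduct.isSolvable (α := φ)
  have := SemidirectProduct.isSolvable (α := representationAction ρ)
  exact Group.isSolvable_of_surjective (f := e.symm.toMonoidHom) e.symm.surjective

theorem IsModuleExtensionOfFrobenius.prime_dvd_natCard_iff {q r : ℕ} [Fact q.Prime]
    [Fact r.Prime] {G : Type*} [Group G] (h : IsModuleExtensionOfFrobenius q r G) {p : ℕ}
    (hp : p.Prime) : p ∣ Nat.card G ↔ p = 2 ∨ p = r ∨ p = q := by
  obtain ⟨φ, V, _, _, _, ρ, -, -, hρ, ⟨e⟩⟩ := h
  rw [Nat.card_congr e.toEquiv, prime_dvd_natCard_moduleExtension_iff hρ hp]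

/-! ### A Frobenius action by quarter turns and its permutation module -/

/-- The homomorphism from the cyclic group of order `n` determined by an element `a` with
`a ^ n = 1`. -/
def zmodPowersHom {K : Type*} [Group K] (n : ℕ) [NeZero n] (a : K) (ha : a ^ n = 1) :
    Multiplicative (ZMod n) →* K where
  toFun i := a ^ i.toAdd.val
  map_one' := by simp
  map_mul' i j := by
    rw [toAdd_mul, ZMod.val_add, ← pow_add]
    exact (pow_eq_pow_mod _ ha).symm

section Quarter

variable (q : ℕ)

/-- The automorphism `(x, y) ↦ (-y, x)` of `ℤ/q × ℤ/q`. -/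
def quarterTurn : MulAut (Multiplicative (ZMod q × ZMod q)) :=
  AddEquiv.toMultiplicative
    { toFun := fun x => (-x.2, x.1)
      invFun := fun x => (x.2, -x.1)
      left_inv := fun x => by simp
      right_inv := fun x => by simp
      map_add' := fun x y => by simp [add_comm] }

theorem quarterTurn_apply (x y : ZMod q) :
    quarterTurn q (.ofAdd (x, y)) = .ofAdd (-y, x) := rfl

theorem quarterTurn_pow_four : quarterTurn q ^ 4 = 1 := by
  have h : ∀ x y, (quarterTurn q ^ 4) (.ofAdd (x, y)) = .ofAdd (x, y) := by
    intro x y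
    simp [pow_succ, quarterTurn_apply]
  exact MulEquiv.ext fun x => h x.1 x.2

/-- The action of `ℤ/4` on `ℤ/q × ℤ/q` by quarter turns. -/
def quarterAction : Multiplicative (ZMod 4) →* MulAut (Multiplicative (ZMod q × ZMod q)) :=
  zmodPowersHom 4 (quarterTurn q) (quarterTurn_pow_four q)

/-- The permutation of two copies of `ℤ/q` that together with the translations generates an
action of the semidirect product of `ℤ/q × ℤ/q` with `ℤ/4`. -/
def quarterPerm : Equiv.Perm (ZMod q ⊕ ZMod q) where
  toFun := Sum.elim Sum.inr fun t => Sum.inl (-t)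
  invFun := Sum.elim (fun s => Sum.inr (-s)) Sum.inl
  left_inv := by rintro (s | t) <;> simp
  right_inv := by rintro (s | t) <;> simp

theorem quarterPerm_pow_four : quarterPerm q ^ 4 = 1 := by
  ext x
  rcases x with s | t <;> simp [pow_succ, quarterPerm]

/-- The action of `ℤ/q × ℤ/q` on two copies of `ℤ/q` by translations. -/
def translationPerm : Multiplicative (ZMod q × ZMod q) →* Equiv.Perm (ZMod q ⊕ ZMod q) where
  toFun x := Equiv.sumCongr (Equiv.addRight x.toAdd.1) (Equiv.addRight x.toAdd.2)
  map_one' := by ext x; rcases x with s | t <;> simp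
  map_mul' x y := by
    ext u
    rcases u with s | t <;> simp [add_comm]

theorem translationPerm_inl (x : Multiplicative (ZMod q × ZMod q)) (s : ZMod q) :
    translationPerm q x (.inl s) = .inl (s + x.toAdd.1) := rfl

theorem translationPerm_inr (x : Multiplicative (ZMod q × ZMod q)) (s : ZMod q) :
    translationPerm q x (.inr s) = .inr (s + x.toAdd.2) := rfl

theorem quarterPerm_inl (s : ZMod q) : quarterPerm q (.inl s) = .inr s := rfl

theorem quarterPerm_inr (s : ZMod q) : quarterPerm q (.inr s) = .inl (-s) := rfl

/-- The compatibility that lets translations and quarter turns combine into an action of the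
semidirect product. -/
theorem translationPerm_quarterTurn (x : Multiplicative (ZMod q × ZMod q)) :
    translationPerm q (quarterTurn q x) = quarterPerm q * translationPerm q x * (quarterPerm q)⁻¹ := by
  rw [eq_mul_inv_iff_mul_eq]
  have h : ∀ x y, translationPerm q (quarterTurn q (.ofAdd (x, y))) * quarterPerm q =
      quarterPerm q * translationPerm q (.ofAdd (x, y)) := by
    intro x y
    ext u
    rcases u with s | t <;>
      simp [translationPerm, quarterTurn_apply, quarterPerm, add_comm]
  exact h x.1 x.2

theorem translationPerm_quarterTurn_pow (n : ℕ) (x : Multiplicative (ZMod q × ZMod q)) :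
    translationPerm q ((quarterTurn q ^ n) x) =
      quarterPerm q ^ n * translationPerm q x * (quarterPerm q ^ n)⁻¹ := by
  induction n with
  | zero => simp
  | succ n ih =>
    rw [pow_succ', MulAut.mul_apply, translationPerm_quarterTurn, ih, pow_succ']
    group

/-- The action of the semidirect product of `ℤ/q × ℤ/q` with `ℤ/4` on two copies of `ℤ/q`. -/
def quarterGroupPerm :
    Multiplicative (ZMod q × ZMod q) ⋊[quarterAction q] Multiplicative (ZMod 4) →*
      Equiv.Perm (ZMod q ⊕ ZMod q) :=
  SemidirectProduct.lift (translationPerm q)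
    (zmodPowersHom 4 (quarterPerm q) (quarterPerm_pow_four q)) fun _ =>
      MonoidHom.ext fun x => translationPerm_quarterTurn_pow q _ x

theorem quarterGroupPerm_inl (x : Multiplicative (ZMod q × ZMod q)) :
    quarterGroupPerm q (.inl x) = translationPerm q x :=
  SemidirectProduct.lift_inl ..

theorem quarterGroupPerm_inr (i : Multiplicative (ZMod 4)) :
    quarterGroupPerm q (.inr i) = quarterPerm q ^ i.toAdd.val :=
  SemidirectProduct.lift_inr ..

theorem isFrobeniusAction_quarterAction [Fact q.Prime] (hq : q ≠ 2) :
    IsFrobeniusAction (quarterAction q) := by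
  have h2 : (2 : ZMod q) ≠ 0 := by
    have : ((2 : ℕ) : ZMod q) ≠ 0 := by
      rw [Ne, CharP.cast_eq_zero_iff (ZMod q) q, Nat.prime_dvd_prime_iff_eq Fact.out Nat.prime_two]
      exact hq
    exact_mod_cast this
  have hneg : ∀ x : ZMod q, -x = x → x = 0 := fun x hx => by
    have : 2 * x = 0 := by linear_combination -hx
    exact (mul_eq_zero.1 this).resolve_left h2
  -- The half turn is negation, without nonzero fixed points for odd `q`. Each nontrivial rotation,
  -- or its square, is the half turn.
  have hsq : ∀ x y, (quarterTurn q ^ 2) (.ofAdd (x, y)) = .ofAdd (x, y) →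
      Multiplicative.ofAdd (x, y) = 1 := fun x y h => by
    rw [pow_two, MulAut.mul_apply, quarterTurn_apply, quarterTurn_apply,
      Multiplicative.ofAdd.injective.eq_iff, Prod.mk.injEq] at h
    rw [hneg x h.1, hneg y h.2]
    rfl
  intro i hi x hx
  refine hsq x.1 x.2 ?_
  change (quarterTurn q ^ 2) x = x
  have hx' : ((quarterTurn q ^ i.toAdd.val) ^ 2) x = x := by
    rw [pow_two, MulAut.mul_apply]
    change quarterAction q i (quarterAction q i x) = x
    rw [hx, hx]
  rw [← pow_mul] at hx'
  have hi4 : i = .ofAdd 1 ∨ i = .ofAdd 2 ∨ i = .ofAdd 3 := by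
    clear hx hx'; revert i; decide
  rcases hi4 with rfl | rfl | rfl
  · exact hx'
  · exact hx
  · have h6 : quarterTurn q ^ 6 = quarterTurn q ^ 2 := by
      rw [show 6 = 4 + 2 by rfl, pow_add, quarterTurn_pow_four, one_mul]
    rw [← h6]
    exact hx'

/-- The representation on functions on a set afforded by a permutation action. -/
def permFunctionRep (k : Type*) {H X : Type*} [CommRing k] [Group H] (π : H →* Equiv.Perm X) :
    Representation k H (X → k) where
  toFun h := LinearMap.funLeft k k (π h).symm
  map_one' := by rw [map_one]; rfl
  map_mul' g h := by
    refine LinearMap.ext fun f => funext fun x => ?_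
    rw [map_mul]
    rfl

theorem permFunctionRep_apply {k H X : Type*} [CommRing k] [Group H] (π : H →* Equiv.Perm X)
    (h : H) (f : X → k) (x : X) : permFunctionRep k π h f (π h x) = f x := by
  change f ((π h).symm (π h x)) = f x
  rw [Equiv.symm_apply_apply]

end Quarter

/-! ### Existence of faithful irreducible modules -/

/-- An irreducible subrepresentation is an atom of the lattice of subrepresentations, which is
finite and hence atomic. -/
theorem Representation.exists_irreducible_le {k G V : Type*} [Field k] [Group G] [AddCommGroup V]
    [Module k V] [Finite V] (ρ : Representation k G V) {M : Subrepresentation ρ} (hM : M ≠ ⊥) :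
    ∃ U ≤ M, U.toRepresentation.IsIrreducible := by
  have : Finite (Subrepresentation ρ) :=
    Finite.of_injective _ (SetLike.coe_injective (A := Subrepresentation ρ))
  obtain ⟨U, hU, hUM⟩ := (IsAtomic.eq_bot_or_exists_atom_le M).resolve_left hM
  refine ⟨U, hUM, ?_⟩
  rw [isIrreducible_iff_forall_submodule]
  constructor
  · rw [Submodule.nontrivial_iff_ne_bot]
    exact fun h => hU.1 (Subrepresentation.toSubmodule_injective h)
  · intro W hW
    let W' : Subrepresentation ρ := ⟨W.map U.toSubmodule.subtype, by
      rintro g _ ⟨w, hw, rfl⟩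
      exact ⟨_, hW g w hw, rfl⟩⟩
    have hle : W' ≤ U := by
      rintro _ ⟨w, -, rfl⟩
      exact w.2
    rcases hU.le_iff.1 hle with h | h
    · left
      have h' : W.map U.toSubmodule.subtype = ⊥ := congrArg Subrepresentation.toSubmodule h
      rwa [← Submodule.map_bot U.toSubmodule.subtype,
        (Submodule.map_injective_of_injective U.toSubmodule.injective_subtype).eq_iff] at h'
    · right
      have h' : W.map U.toSubmodule.subtype = U.toSubmodule :=
        congrArg Subrepresentation.toSubmodule h
      rw [eq_top_iff]
      rintro ⟨u, hu⟩ -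
      rw [← h'] at hu
      obtain ⟨w, hw, rfl⟩ := hu
      exact hw

theorem ZMod.eq_of_periodic {q : ℕ} [Fact q.Prime] {β : Type*} {f : ZMod q → β} {x : ZMod q}
    (hx : x ≠ 0) (hf : ∀ s, f (s + x) = f s) (s : ZMod q) : f s = f 0 := by
  have h : ∀ n : ℕ, f (n * x) = f 0 := by
    intro n
    induction n with
    | zero => simp
    | succ n ih => rw [Nat.cast_succ, add_mul, one_mul, hf, ih]
  have := h (s * x⁻¹).val
  rwa [ZMod.natCast_val, ZMod.cast_id, mul_assoc, inv_mul_cancel₀ hx, mul_one] at this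

section Existence

variable (q r : ℕ) [Fact q.Prime] [Fact r.Prime]

/-- The functions on two copies of `ℤ/q` whose sum over each copy is zero. -/
def sumZeroSubmodule : Submodule (ZMod r) (ZMod q ⊕ ZMod q → ZMod r) where
  carrier := {f | ∑ s, f (.inl s) = 0 ∧ ∑ s, f (.inr s) = 0}
  add_mem' := fun ha hb => by
    constructor
    · simp [Finset.sum_add_distrib, ha.1, hb.1]
    · simp [Finset.sum_add_distrib, ha.2, hb.2]
  zero_mem' := by simp
  smul_mem' := fun c f hf => by
    constructor
    · simp [← Finset.mul_sum, hf.1]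
    · simp [← Finset.mul_sum, hf.2]

theorem mem_sumZeroSubmodule {f : ZMod q ⊕ ZMod q → ZMod r} :
    f ∈ sumZeroSubmodule q r ↔ ∑ s, f (.inl s) = 0 ∧ ∑ s, f (.inr s) = 0 := Iff.rfl

variable {q r} in
theorem permFunctionRep_inl_mem_sumZeroSubmodule (x : Multiplicative (ZMod q × ZMod q))
    {f : ZMod q ⊕ ZMod q → ZMod r} (hf : f ∈ sumZeroSubmodule q r) :
    permFunctionRep (ZMod r) (quarterGroupPerm q) (.inl x) f ∈ sumZeroSubmodule q r := by
  rw [mem_sumZeroSubmodule] at hf ⊢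
  have h : ∀ u, permFunctionRep (ZMod r) (quarterGroupPerm q) (.inl x) f
      (translationPerm q x u) = f u := fun u => by
    rw [← quarterGroupPerm_inl, permFunctionRep_apply]
  generalize permFunctionRep (ZMod r) (quarterGroupPerm q) (.inl x) f = f' at h ⊢
  constructor
  · rw [← hf.1]
    refine (Fintype.sum_equiv (Equiv.addRight x.toAdd.1) _ _ fun s => ?_).symm
    rw [← h, translationPerm_inl, Equiv.coe_addRight]
  · rw [← hf.2]
    refine (Fintype.sum_equiv (Equiv.addRight x.toAdd.2) _ _ fun s => ?_).symm
    rw [← h, translationPerm_inr, Equiv.coe_addRight]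

variable {q r} in
theorem permFunctionRep_inr_one_mem_sumZeroSubmodule
    {f : ZMod q ⊕ ZMod q → ZMod r} (hf : f ∈ sumZeroSubmodule q r) :
    permFunctionRep (ZMod r) (quarterGroupPerm q) (.inr (.ofAdd 1)) f ∈ sumZeroSubmodule q r := by
  rw [mem_sumZeroSubmodule] at hf ⊢
  have hperm : quarterGroupPerm q (.inr (.ofAdd 1)) = quarterPerm q := by
    rw [quarterGroupPerm_inr]
    exact pow_one _
  have h : ∀ u, permFunctionRep (ZMod r) (quarterGroupPerm q) (.inr (.ofAdd 1)) f
      (quarterPerm q u) = f u := fun u => by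
    rw [← hperm, permFunctionRep_apply]
  generalize permFunctionRep (ZMod r) (quarterGroupPerm q) (.inr (.ofAdd 1)) f = f' at h ⊢
  constructor
  · rw [← hf.2]
    refine (Fintype.sum_equiv (Equiv.neg _) _ _ fun s => ?_).symm
    rw [← h, quarterPerm_inr, Equiv.neg_apply]
  · rw [← hf.1]
    refine (Fintype.sum_congr _ _ fun s => ?_).symm
    rw [← h, quarterPerm_inl]

variable {q r} in
theorem permFunctionRep_mem_sumZeroSubmodule
    (g : Multiplicative (ZMod q × ZMod q) ⋊[quarterAction q] Multiplicative (ZMod 4))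
    {f : ZMod q ⊕ ZMod q → ZMod r} (hf : f ∈ sumZeroSubmodule q r) :
    permFunctionRep (ZMod r) (quarterGroupPerm q) g f ∈ sumZeroSubmodule q r := by
  obtain ⟨x, i⟩ := g
  have hinr : ∀ n : ℕ, permFunctionRep (ZMod r) (quarterGroupPerm q)
      (.inr (Multiplicative.ofAdd (1 : ZMod 4) ^ n)) f ∈ sumZeroSubmodule q r := by
    intro n
    induction n with
    | zero => rwa [pow_zero, map_one, map_one]
    | succ n ih =>
      rw [pow_succ', map_mul, map_mul]
      exact permFunctionRep_inr_one_mem_sumZeroSubmodule ih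
  obtain ⟨n, hn⟩ : ∃ n : ℕ, Multiplicative.ofAdd (1 : ZMod 4) ^ n = i :=
    ⟨i.toAdd.val, by revert i; decide⟩
  rw [SemidirectProduct.mk_eq_inl_mul_inr, map_mul, ← hn]
  exact permFunctionRep_inl_mem_sumZeroSubmodule x (hinr n)

/-- The functions on two copies of `ℤ/q` whose sum over each copy is zero, as a
subrepresentation. -/
def sumZeroSubrepresentation :
    Subrepresentation (permFunctionRep (ZMod r) (quarterGroupPerm q)) where
  toSubmodule := sumZeroSubmodule q r
  apply_mem_toSubmodule g _ hf := permFunctionRep_mem_sumZeroSubmodule g hf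

theorem sumZeroSubrepresentation_ne_bot : sumZeroSubrepresentation q r ≠ ⊥ := by
  classical
  let f : ZMod q ⊕ ZMod q → ZMod r := Sum.elim (Pi.single 0 1 - Pi.single 1 1) 0
  have hf : f ∈ sumZeroSubrepresentation q r := by
    constructor <;> simp [f]
  intro h
  rw [h] at hf
  have : f (.inl 0) = 0 := by
    have hf0 : f = 0 := hf
    rw [hf0]
    rfl
  simp [f] at this

variable {q r}

/-- Some coordinate of `x` is nonzero and the quarter turn moves it to the other copy, so `f` is
constant on both copies. A constant with zero sum vanishes since `q` is invertible modulo `r`. -/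
theorem eq_zero_of_fixed_of_sumZero (hrq : r ≠ q) {f : ZMod q ⊕ ZMod q → ZMod r}
    (hf : f ∈ sumZeroSubrepresentation q r) {x : Multiplicative (ZMod q × ZMod q)} (hx : x ≠ 1)
    (h₁ : permFunctionRep (ZMod r) (quarterGroupPerm q) (.inl x) f = f)
    (h₂ : permFunctionRep (ZMod r) (quarterGroupPerm q) (.inl (quarterTurn q x)) f = f) :
    f = 0 := by
  have hq : (q : ZMod r) ≠ 0 := by
    rw [Ne, CharP.cast_eq_zero_iff (ZMod r) r, Nat.prime_dvd_prime_iff_eq Fact.out Fact.out]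
    exact hrq
  have key : ∀ y, permFunctionRep (ZMod r) (quarterGroupPerm q) (.inl y) f = f →
      ∀ u, f (translationPerm q y u) = f u := fun y hy u => by
    have := permFunctionRep_apply (quarterGroupPerm q) (.inl y) f u
    rwa [hy, quarterGroupPerm_inl] at this
  have hconst : (∀ s, f (.inl s) = f (.inl 0)) ∧ (∀ s, f (.inr s) = f (.inr 0)) := by
    by_cases hx1 : x.toAdd.1 = 0
    · have hx2 : x.toAdd.2 ≠ 0 := fun hx2 => hx (Prod.ext hx1 hx2)
      exact ⟨fun s => ZMod.eq_of_periodic (f := fun s => f (.inl s)) (neg_ne_zero.2 hx2)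
        (fun s => key _ h₂ (.inl s)) s,
        fun s => ZMod.eq_of_periodic (f := fun s => f (.inr s)) hx2
          (fun s => key _ h₁ (.inr s)) s⟩
    · exact ⟨fun s => ZMod.eq_of_periodic (f := fun s => f (.inl s)) hx1
        (fun s => key _ h₁ (.inl s)) s,
        fun s => ZMod.eq_of_periodic (f := fun s => f (.inr s)) hx1
          (fun s => key _ h₂ (.inr s)) s⟩
  have h0 : ∀ g : ZMod q → ZMod r, (∀ s, g s = g 0) → ∑ s, g s = 0 → ∀ s, g s = 0 := by
    intro g hg hsum s
    rw [Fintype.sum_congr _ _ hg, Finset.sum_const, Finset.card_univ, ZMod.card,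
      ← Nat.cast_smul_eq_nsmul (ZMod r), smul_eq_zero] at hsum
    rw [hg, hsum.resolve_left hq]
  ext u
  rcases u with s | s
  · exact h0 _ hconst.1 hf.1 s
  · exact h0 _ hconst.2 hf.2 s

/-- The commutator of an element outside `Q` with any `y ≠ 1` in `Q` lies in `N ∩ Q`, and is
nontrivial because the action is Frobenius. -/
theorem IsFrobeniusAction.exists_inl_mem {Q P : Type*} [CommGroup Q] [Nontrivial Q] [Group P]
    {φ : P →* MulAut Q} (hφ : IsFrobeniusAction φ) {N : Subgroup (Q ⋊[φ] P)} [N.Normal]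
    (hN : N ≠ ⊥) : ∃ x ≠ 1, SemidirectProduct.inl x ∈ N := by
  obtain ⟨h, hh, h1⟩ := (Subgroup.ne_bot_iff_exists_ne_one).1 hN |>.elim fun a ha =>
    (⟨a, a.2, fun h => ha (Subtype.ext h)⟩ : ∃ h, h ∈ N ∧ h ≠ 1)
  by_cases hp : h.right = 1
  · have he : h = .inl h.left := SemidirectProduct.ext rfl hp
    refine ⟨h.left, fun hl => h1 (SemidirectProduct.ext hl hp), he ▸ hh⟩
  · obtain ⟨y, hy⟩ := exists_ne (1 : Q)
    refine ⟨φ h.right y * y⁻¹, fun hc => hy (hφ _ hp y (mul_inv_eq_one.1 hc)), ?_⟩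
    have h2 := N.mul_mem hh (‹N.Normal›.conj_mem _ (N.inv_mem hh) (.inl y))
    have h3 : h * .inl y * h⁻¹ = .inl (φ h.right y) := by
      rw [mul_inv_eq_iff_eq_mul]
      ext <;> simp [mul_comm]
    rw [map_mul, ← h3, map_inv]
    simpa only [mul_assoc] using h2

theorem exists_isModuleExtensionOfFrobenius (hq : q ≠ 2) (hrq : r ≠ q) :
    ∃ (G : Type) (_ : Group G), IsModuleExtensionOfFrobenius q r G := by
  obtain ⟨U, hU, hirr⟩ :=
    (permFunctionRep (ZMod r) (quarterGroupPerm q)).exists_irreducible_le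
      (sumZeroSubrepresentation_ne_bot q r)
  refine ⟨_, _, quarterAction q, U.toSubmodule, inferInstance, inferInstance, inferInstance,
    U.toRepresentation, isFrobeniusAction_quarterAction q hq, ?_, hirr, ⟨MulEquiv.refl _⟩⟩
  rw [← MonoidHom.ker_eq_bot_iff]
  -- A nontrivial kernel meets `Q` in some `x ≠ 1` and, being normal, also contains its quarter
  -- turn; together these fix no nonzero sum-zero function.
  by_contra hker
  obtain ⟨x, hx, hxN⟩ := (isFrobeniusAction_quarterAction q hq).exists_inl_mem hker
  have hxN' : SemidirectProduct.inl (quarterTurn q x) ∈ MonoidHom.ker U.toRepresentation := by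
    have := (MonoidHom.normal_ker U.toRepresentation).conj_mem _ hxN (.inr (.ofAdd 1))
    rw [← map_inv, ← SemidirectProduct.inl_aut] at this
    exact this
  have := hirr.nontrivial
  obtain ⟨⟨f, hf⟩, hf0⟩ := exists_ne (0 : U.toSubmodule)
  refine hf0 (Subtype.ext (eq_zero_of_fixed_of_sumZero hrq (hU hf) hx ?_ ?_))
  · exact congrArg Subtype.val (DFunLike.congr_fun (MonoidHom.mem_ker.1 hxN) ⟨f, hf⟩)
  · exact congrArg Subtype.val (DFunLike.congr_fun (MonoidHom.mem_ker.1 hxN') ⟨f, hf⟩)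

end Existence

/-! ### Assembly and the infinite family -/

theorem IsModuleExtensionOfFrobenius.properties {q r : ℕ} [Fact r.Prime] (hq : q.Prime)
    (hq2 : q ≠ 2) (hr2 : r ≠ 2) (hrq : r ≠ q) {G : Type*} [Group G]
    (h : IsModuleExtensionOfFrobenius q r G) :
    Finite G ∧ Group.IsSolvable G ∧ IsTwoPath (primeGraph G) ∧ IsTriangle (codegreeGraph G) := by
  have := Fact.mk hq
  refine ⟨h.finite, h.isSolvable, ?_⟩
  obtain ⟨φ, V, _, _, _, ρ, hφ, hinj, hρ, ⟨e⟩⟩ := h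
  exact graphs_of_moduleExtension hq2 hr2 hrq hφ hinj hρ e

theorem mainTheorem5 :
    -- there are infinitely many (pairwise non-isomorphic) groups as claimed, of the given form
    (∃ (G : ℕ → Type) (_ : ∀ i, Group (G i)),
      (∀ i j, i ≠ j → IsEmpty (G i ≃* G j)) ∧
      ∀ i, Finite (G i) ∧ Group.IsSolvable (G i) ∧
        IsTwoPath (primeGraph (G i)) ∧ IsTriangle (codegreeGraph (G i)) ∧
        ∃ (q r : ℕ) (_ : Fact r.Prime), q.Prime ∧ q ≠ 2 ∧ r ≠ 2 ∧ r ≠ q ∧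
          IsModuleExtensionOfFrobenius q r (G i)) ∧
    -- every group of the given form is as claimed
    (∀ (q r : ℕ) [Fact r.Prime], q.Prime → q ≠ 2 → r ≠ 2 → r ≠ q →
      ∀ (G : Type*) [Group G], IsModuleExtensionOfFrobenius q r G →
        Finite G ∧ Group.IsSolvable G ∧
          IsTwoPath (primeGraph G) ∧ IsTriangle (codegreeGraph G)) ∧
    -- groups of the given form exist for all odd primes `q ≠ r`
    (∀ (q r : ℕ) [Fact r.Prime], q.Prime → q ≠ 2 → r ≠ 2 → r ≠ q →
      ∃ (G : Type) (_ : Group G), IsModuleExtensionOfFrobenius q r G) := by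
  refine ⟨?_, fun q r _ hq hq2 hr2 hrq G _ h => h.properties hq hq2 hr2 hrq,
    fun q r _ hq hq2 _ hrq => by
      have := Fact.mk hq
      exact exists_isModuleExtensionOfFrobenius hq2 hrq⟩
  -- Counting from zero, the shift by two skips the primes `2` and `3`, the latter being reserved
  -- for `q`.
  let r : ℕ → ℕ := fun i => Nat.nth Nat.Prime (i + 2)
  have hrp : ∀ i, Fact (r i).Prime := fun i => ⟨Nat.prime_nth_prime _⟩
  have hr3 : ∀ i, 3 < r i := fun i => by
    have := Nat.nth_strictMono Nat.infinite_setOfPred_prime (show 1 < i + 2 by omega)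
    rwa [Nat.nth_prime_one_eq_three] at this
  have hinj : Function.Injective r := fun i j h =>
    Nat.add_right_cancel (Nat.nth_injective Nat.infinite_setOfPred_prime h)
  choose G hG hext using fun i =>
    exists_isModuleExtensionOfFrobenius (q := 3) (r := r i) (by norm_num) (hr3 i).ne'
  refine ⟨G, hG, fun i j hij => ⟨fun e => ?_⟩, fun i => ?_⟩
  -- An isomorphism would make `r i` divide the order of `G j`, whose prime divisors are `2`, `3`
  -- and `r j`.
  · have h := ((hext i).prime_dvd_natCard_iff (hrp i).out).2 (Or.inr (Or.inl rfl))
    rw [Nat.card_congr e.toEquiv, (hext j).prime_dvd_natCard_iff (hrp i).out] at h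
    have h3 := hr3 i
    rcases h with h | h | h
    · omega
    · exact hij (hinj h)
    · omega
  · have h3 := hr3 i
    obtain ⟨h₁, h₂, h₃, h₄⟩ := (hext i).properties Nat.prime_three (by norm_num)
      (by omega) (by omega)
    exact ⟨h₁, h₂, h₃, h₄, 3, r i, hrp i, Nat.prime_three, by norm_num, by omega, by omega, hext i⟩
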